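/- Let $d\in\{2,3\}$, let $\Omega\subset\mathbb{R}^d$ be a bounded open set (in particular, $\Omega$ may be any bounded connected open set with Lipschitz boundary $\Gamma=\partial\Omega$), and let $\lambda>0$ and $p>0$ be real numbers. Let $H^2(\Omega)$ be the Sobolev space of real functions in $L^2(\Omega)$ whose weak derivatives of order at most $2$ lie in $L^2(\Omega)$, with norm $\|u\|_{2}=\big(\sum_{|\alpha|\le 2}\|D^\alpha u\|_{L^2(\Omega)}^2\big)^{1/2}$, let $H_0^2(\Omega)$ be the closure of $C_c^\infty(\Omega)$ in $H^2(\Omega)$, let $H^{-2}(\Omega)$ be the topological dual of $H_0^2(\Omega)$, and let $f\in H^{-2}(\Omega)$. Then the nonlinear plate bending problem $$\Delta^2u+\lambda|u|^{2p}u=f\ \text{ in }\Omega,\qquad u=\frac{\partial u}{\partial n}=0\ \text{ on }\Gamma,$$ has a unique weak solution in $H_0^2(\Omega)$. That is, the function $|u|^{2p}u\,v$ is integrable on $\Omega$ for all $u,v\in H_0^2(\Omega)$, and there is exactly one $u\in H_0^2(\Omega)$ such that $$\int_\Omega \Delta u\,\Delta v\,dx+\lambda\int_\Omega|u|^{2p}u\,v\,dx=\langle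 f,v\rangle\qquad\text{for all }v\in H_0^2(\Omega).$$ -/

import Mathlib

open MeasureTheory TopologicalSpace
open scoped Distributions LineDeriv

noncomputable section

namespace PlateBending

/-- Multi-indices `α ∈ ℕ ^ d` of order `|α| = α₁ + ⋯ + α_d ≤ m`. -/
abbrev MultiIndex (d m : ℕ) : Type :=
  {α : Fin d → Fin (m + 1) // ∑ i, (α i : ℕ) ≤ m}

namespace MultiIndex

/-- The order `|α|` of a multi-index. -/
def order {d m : ℕ} (α : MultiIndex d m) : ℕ := ∑ i, (α.1 i : ℕ)

/-- The zero multi-index. -/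
def zero (d m : ℕ) : MultiIndex d m := ⟨fun _ => 0, by simp⟩

/-- The multi-index `2 eᵢ`, which belongs to the derivative `∂²/∂xᵢ²`. -/
def twice {d : ℕ} (i : Fin d) : MultiIndex d 2 :=
  ⟨Pi.single i 2, by
    rw [Finset.sum_eq_single i (fun j _ hj => by simp [Pi.single_eq_of_ne hj]) (by simp)]
    simp⟩

end MultiIndex

variable {d m : ℕ} {Ω : Opens (EuclideanSpace ℝ (Fin d))}

/-- The classical derivative `D^α φ = ∂₁^α₁ ⋯ ∂_d^α_d φ` of a test function `φ ∈ C_c^∞(Ω)`. -/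
def testDeriv (α : MultiIndex d m) (φ : 𝓓(Ω, ℝ)) : 𝓓(Ω, ℝ) :=
  (List.finRange d).foldr
    (fun i ψ => (fun χ : 𝓓(Ω, ℝ) => ∂_{EuclideanSpace.single i (1 : ℝ)} χ)^[(α.1 i : ℕ)] ψ) φ

theorem testDeriv_zero (α : MultiIndex d m) : testDeriv α (0 : 𝓓(Ω, ℝ)) = 0 := by
  unfold testDeriv
  induction List.finRange d with
  | nil => rfl
  | cons i l ih =>
    rw [List.foldr_cons, ih]
    exact Function.iterate_fixed (LineDeriv.lineDerivOp_zero _) _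

theorem testDeriv_add (α : MultiIndex d m) (φ ψ : 𝓓(Ω, ℝ)) :
    testDeriv α (φ + ψ) = testDeriv α φ + testDeriv α ψ := by
  unfold testDeriv
  induction List.finRange d with
  | nil => rfl
  | cons i l ih =>
    simp only [List.foldr_cons, ih]
    generalize List.foldr _ φ l = a
    generalize List.foldr _ ψ l = b
    induction (α.1 i : ℕ) with
    | zero => rfl
    | succ n ihn => simp only [Function.iterate_succ_apply', ihn, LineDeriv.lineDerivOp_add]

theorem testDeriv_smul (α : MultiIndex d m) (c : ℝ) (φ : 𝓓(Ω, ℝ)) :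
    testDeriv α (c • φ) = c • testDeriv α φ := by
  unfold testDeriv
  induction List.finRange d with
  | nil => rfl
  | cons i l ih =>
    simp only [List.foldr_cons, ih]
    generalize List.foldr _ φ l = a
    induction (α.1 i : ℕ) with
    | zero => rfl
    | succ n ihn => simp only [Function.iterate_succ_apply', ihn, LineDeriv.lineDerivOp_smul]

/-- The real Hilbert space `L²(Ω)`. -/
abbrev L2 (Ω : Opens (EuclideanSpace ℝ (Fin d))) : Type :=
  Lp ℝ 2 (volume.restrict (Ω : Set (EuclideanSpace ℝ (Fin d))))

theorem integrable_mul_test (g : L2 Ω) (φ : 𝓓(Ω, ℝ)) :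
    Integrable (fun x => g x * φ x) (volume.restrict (Ω : Set (EuclideanSpace ℝ (Fin d)))) :=
  have h : MemLp φ 2 (volume.restrict (Ω : Set (EuclideanSpace ℝ (Fin d)))) :=
    φ.continuous.memLp_of_hasCompactSupport φ.hasCompactSupport
  MemLp.integrable_mul (Lp.memLp g) h

/-- `g` is the weak derivative `D^α u` of `u` in `Ω`. -/
def IsWeakDeriv (α : MultiIndex d m) (u g : L2 Ω) : Prop :=
  ∀ φ : 𝓓(Ω, ℝ),
    ∫ x in Ω, u x * testDeriv α φ x = (-1 : ℝ) ^ α.order * ∫ x in Ω, g x * φ x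

/-- The Sobolev space `H^m(Ω) = W^{m,2}(Ω)`. A function `u ∈ H^m(Ω)` is given by the family
`(D^α u)_{|α| ≤ m}` of its weak derivatives in `L²(Ω)` (the family is determined by its member
`u = D^0 u`), so that the norm inherited from the Hilbert sum of copies of `L²(Ω)` is the norm
`‖u‖_m = (∑_{|α| ≤ m} ‖D^α u‖²_{L²(Ω)})^{1/2}`. -/
def H (m : ℕ) (Ω : Opens (EuclideanSpace ℝ (Fin d))) :
    Submodule ℝ (PiLp 2 (fun _ : MultiIndex d m => L2 Ω)) where
  carrier := {U | ∀ α, IsWeakDeriv α (U (MultiIndex.zero d m)) (U α)}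
  zero_mem' := by
    intro α φ
    have h : ∀ ψ : 𝓓(Ω, ℝ), ∫ x in Ω, (0 : L2 Ω) x * ψ x = 0 := by
      intro ψ
      rw [← integral_zero (EuclideanSpace ℝ (Fin d)) ℝ
        (μ := volume.restrict (Ω : Set (EuclideanSpace ℝ (Fin d))))]
      refine integral_congr_ae ?_
      filter_upwards [Lp.coeFn_zero ℝ 2
        (volume.restrict (Ω : Set (EuclideanSpace ℝ (Fin d))))] with x hx
      rw [hx, Pi.zero_apply, zero_mul]
    simp only [PiLp.zero_apply, h, mul_zero]
  add_mem' := by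
    intro U V hU hV α φ
    have h : ∀ (g k : L2 Ω) (ψ : 𝓓(Ω, ℝ)), ∫ x in Ω, (g + k) x * ψ x =
        (∫ x in Ω, g x * ψ x) + ∫ x in Ω, k x * ψ x := by
      intro g k ψ
      rw [← integral_add (integrable_mul_test g ψ) (integrable_mul_test k ψ)]
      refine integral_congr_ae ?_
      filter_upwards [Lp.coeFn_add g k] with x hx
      rw [hx, Pi.add_apply, add_mul]
    rw [PiLp.add_apply, PiLp.add_apply, h, h, hU α φ, hV α φ, mul_add]
  smul_mem' := by
    intro c U hU α φ
    have h : ∀ (g : L2 Ω) (ψ : 𝓓(Ω, ℝ)), ∫ x in Ω, (c • g) x * ψ x =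
        c * ∫ x in Ω, g x * ψ x := by
      intro g ψ
      rw [← integral_const_mul]
      refine integral_congr_ae ?_
      filter_upwards [Lp.coeFn_smul c g] with x hx
      rw [hx, Pi.smul_apply, smul_eq_mul, mul_assoc]
    rw [PiLp.smul_apply, PiLp.smul_apply, h, h, hU α φ]
    ring

/-- The underlying function of an element of `H^m(Ω)`. -/
def H.toL2 (u : H m Ω) : L2 Ω := u.1 (MultiIndex.zero d m)

/-- The weak derivative `D^α u` of `u ∈ H^m(Ω)`. -/
def H.deriv (α : MultiIndex d m) (u : H m Ω) : L2 Ω := u.1 α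

/-- The subspace `C_c^∞(Ω)` of `H^m(Ω)`: a test function `φ` is the family `(D^α φ)_{|α| ≤ m}`
of its classical derivatives. -/
def testSubspace (m : ℕ) (Ω : Opens (EuclideanSpace ℝ (Fin d))) : Submodule ℝ (H m Ω) where
  carrier := {u | ∃ φ : 𝓓(Ω, ℝ), ∀ α,
    H.deriv α u =ᵐ[volume.restrict (Ω : Set (EuclideanSpace ℝ (Fin d)))] testDeriv α φ}
  zero_mem' := by
    refine ⟨0, fun α => ?_⟩
    filter_upwards [Lp.coeFn_zero ℝ 2
      (volume.restrict (Ω : Set (EuclideanSpace ℝ (Fin d))))] with x hx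
    rw [testDeriv_zero]
    exact hx
  add_mem' := by
    rintro u v ⟨φ, hφ⟩ ⟨ψ, hψ⟩
    refine ⟨φ + ψ, fun α => ?_⟩
    filter_upwards [hφ α, hψ α, Lp.coeFn_add (H.deriv α u) (H.deriv α v)] with x h1 h2 h3
    rw [testDeriv_add]
    exact h3.trans (by rw [Pi.add_apply, h1, h2]; rfl)
  smul_mem' := by
    rintro c u ⟨φ, hφ⟩
    refine ⟨c • φ, fun α => ?_⟩
    filter_upwards [hφ α, Lp.coeFn_smul c (H.deriv α u)] with x h1 h2
    rw [testDeriv_smul]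
    exact h2.trans (by rw [Pi.smul_apply, h1]; rfl)

/-- `H_0^m(Ω)`, the closure of `C_c^∞(Ω)` in `H^m(Ω)`, with the norm of `H^m(Ω)`. -/
def H0 (m : ℕ) (Ω : Opens (EuclideanSpace ℝ (Fin d))) : Submodule ℝ (H m Ω) :=
  (testSubspace m Ω).topologicalClosure

/-- `H^{-m}(Ω)`, the topological dual of `H_0^m(Ω)`, with the dual norm. -/
abbrev HNeg (m : ℕ) (Ω : Opens (EuclideanSpace ℝ (Fin d))) : Type :=
  StrongDual ℝ (H0 m Ω)

/-- The weak Laplacian `Δ u = ∑ᵢ ∂²u/∂xᵢ² ∈ L²(Ω)` of `u ∈ H²(Ω)`. -/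
def H.laplacian (u : H 2 Ω) : L2 Ω := ∑ i : Fin d, H.deriv (MultiIndex.twice i) u

/-- `u ∈ H_0^2(Ω)` is a weak solution of `Δ² u + λ |u|^{2p} u = f` in `Ω`,
`u = ∂u/∂n = 0` on `∂Ω`. The boundary conditions are the membership in `H_0^2(Ω)`. -/
def IsWeakSolution (lam p : ℝ) (f : HNeg 2 Ω) (u : H0 2 Ω) : Prop :=
  ∀ v : H0 2 Ω,
    (∫ x in Ω, H.laplacian u.1 x * H.laplacian v.1 x) +
      lam * (∫ x in Ω, |H.toL2 u.1 x| ^ (2 * p) * H.toL2 u.1 x * H.toL2 v.1 x) = f v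

end PlateBending

end

noncomputable section

namespace PlateBending

variable {d m : ℕ} {Ω : Opens (EuclideanSpace ℝ (Fin d))}

open scoped SchwartzMap FourierTransform Laplacian NNReal

/-! By the Riesz isomorphism the weak equation reads `A u = 0` in the Hilbert space `H0 2 Ω`, where
`A u = Δ*Δu + λ T* g(T u) - f`, `T` is the embedding into `L²(Ω)` and `g(s) = |s|^(2p) s`. Since `g`
is monotone, `A` is strongly monotone once `‖Δu‖` controls the `H²` norm
(`exists_norm_sq_le_norm_laplacian_sq`): integration by parts bounds the second derivatives, and
Poincaré's inequality on the bounded set `Ω` the lower ones.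

Zarantonello's theorem also asks for a Lipschitz operator, which `g` does not give. But in dimension
below four `H0 2 Ω` embeds in `L^∞` (`exists_ae_abs_toL2_le`), so truncating `g` at a level `M`
changes nothing for functions in a suitable ball. Strong monotonicity bounds the zero of the
truncated operator by `K ‖f‖` independently of `M`; hence a suitable `M` makes that zero a true
solution. Two solutions are zeros of one operator truncated above both, and so coincide.

All estimates are proved for test functions extended by zero to the whole space and pass to the
closure, so no regularity of the boundary is used. -/

/-! ### A priori estimates for Schwartz functions -/

theorem lineDerivOp_comm {E : Type*} [NormedAddCommGroup E] [NormedSpace ℝ E]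
    (f : 𝓢(E, ℝ)) (v w : E) : ∂_{v} (∂_{w} f) = ∂_{w} (∂_{v} f) := by
  have h : ∀ (v w x : E), ∂_{v} (∂_{w} f) x = fderiv ℝ (fderiv ℝ f) x v w := by
    intro v w x
    have hw : ⇑(∂_{w} f : 𝓢(E, ℝ)) = fun y => fderiv ℝ f y w :=
      funext fun y => SchwartzMap.lineDerivOp_apply_eq_fderiv w f y
    rw [SchwartzMap.lineDerivOp_apply_eq_fderiv, hw, fderiv_clm_apply
      (((f.smooth 2).fderiv_right (m := 1) le_rfl).differentiable one_ne_zero x)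
      (differentiableAt_const w)]
    simp
  ext x
  rw [h, h]
  exact (f.smooth 2).contDiffAt.isSymmSndFDerivAt (by simp) v w

section Schwartz

variable {E : Type*} [NormedAddCommGroup E] [InnerProductSpace ℝ E] [FiniteDimensional ℝ E]
  [MeasurableSpace E] [BorelSpace E]

theorem fourier_laplacian_apply (f : 𝓢(E, ℂ)) (ξ : E) :
    𝓕 (Δ f) ξ = -(2 * Real.pi * ‖ξ‖) ^ 2 * 𝓕 f ξ := by
  have hg : ∀ v : E, (inner ℝ · v : E → ℝ).HasTemperateGrowth := fun v =>
    ((innerSL ℝ).flip v).hasTemperateGrowth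
  have h : ∀ v : E, 𝓕 (∂_{v} (∂_{v} f)) ξ =
      -(2 * Real.pi) ^ 2 * ((inner ℝ ξ v : ℝ) : ℂ) ^ 2 * 𝓕 f ξ := by
    intro v
    rw [SchwartzMap.fourier_lineDerivOp_eq, SchwartzMap.fourier_lineDerivOp_eq]
    simp only [smul_apply, SchwartzMap.smulLeftCLM_apply_apply (hg v), smul_eq_mul,
      Complex.real_smul]
    linear_combination (2 * Real.pi) ^ 2 * ((inner ℝ ξ v : ℝ) : ℂ) ^ 2 * 𝓕 f ξ * Complex.I_sq
  rw [SchwartzMap.laplacian_eq_sum (stdOrthonormalBasis ℝ E), FourierTransform.fourier_sum,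
    sum_apply]
  simp_rw [h]
  rw [← Finset.sum_mul, ← Finset.mul_sum]
  have := (stdOrthonormalBasis ℝ E).sum_sq_inner_left ξ
  have h2 : ∑ i, ((inner ℝ ξ (stdOrthonormalBasis ℝ E i) : ℝ) : ℂ) ^ 2 = (‖ξ‖ : ℂ) ^ 2 := by
    exact_mod_cast this
  rw [h2]
  ring

/-- The Sobolev embedding `H² ⊂ L^∞` in dimension at most three, for Schwartz functions. -/
theorem exists_norm_le_integral_sub_laplacian (hE : Module.finrank ℝ E < 4) :
    ∃ C : ℝ, 0 ≤ C ∧ ∀ (f : 𝓢(E, ℂ)) (x : E),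
      ‖f x‖ ≤ C * √(∫ y, ‖(f - Δ f) y‖ ^ 2) := by
  -- The squared weight is `(1 + ‖ξ‖²)^(-4/2)`, integrable exactly because the dimension is below
  -- `4`.
  have hint : Integrable (fun ξ : E => ((1 + ‖ξ‖ ^ 2) ^ (-(1 : ℝ))) ^ 2) := by
    have := integrable_rpow_neg_one_add_norm_sq (E := E) (μ := volume) (r := 4)
      (by exact_mod_cast hE)
    refine this.congr (.of_forall fun ξ => ?_)
    simp only
    rw [← Real.rpow_mul_natCast (by positivity)]
    norm_num
  have hmem : MemLp (fun ξ : E => (1 + ‖ξ‖ ^ 2) ^ (-(1 : ℝ))) (ENNReal.ofReal 2) := by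
    rw [show ENNReal.ofReal 2 = 2 by simp, memLp_two_iff_integrable_sq]
    · exact hint
    · exact Measurable.aestronglyMeasurable (by fun_prop)
  refine ⟨√(∫ ξ : E, ((1 + ‖ξ‖ ^ 2) ^ (-(1 : ℝ))) ^ 2), Real.sqrt_nonneg _, fun f x => ?_⟩
  -- The symbol `1 + (2π‖ξ‖)²` of `1 - Δ` dominates `1 + ‖ξ‖²`.
  have hF : ∀ ξ : E, ‖𝓕 f ξ‖ ≤ (1 + ‖ξ‖ ^ 2) ^ (-(1 : ℝ)) * ‖𝓕 (f - Δ f) ξ‖ := by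
    intro ξ
    have h1 : 𝓕 (f - Δ f) ξ = ((1 + (2 * Real.pi * ‖ξ‖) ^ 2 : ℝ) : ℂ) * 𝓕 f ξ := by
      rw [show 𝓕 (f - Δ f) = 𝓕 f - 𝓕 (Δ f) from
        map_sub (FourierTransform.fourierCLM ℂ 𝓢(E, ℂ)) _ _, sub_apply, fourier_laplacian_apply]
      push_cast
      ring
    rw [h1, norm_mul, Complex.norm_real, Real.norm_of_nonneg (by positivity), Real.rpow_neg_one,
      ← mul_assoc]
    refine le_mul_of_one_le_left (norm_nonneg _) ?_
    rw [inv_mul_eq_div, one_le_div (by positivity), mul_pow]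
    have : 1 ≤ (2 * Real.pi) ^ 2 := one_le_pow₀ (by linarith [Real.pi_gt_three])
    nlinarith [sq_nonneg ‖ξ‖]
  have hx : ‖f x‖ ≤ ∫ ξ, ‖𝓕 f ξ‖ := by
    have h1 : f x = 𝓕⁻ (𝓕 f : 𝓢(E, ℂ)) x := by rw [FourierTransform.fourierInv_fourier_eq]
    rw [h1, SchwartzMap.fourierInv_coe, Real.fourierInv_eq]
    refine (norm_integral_le_integral_norm _).trans_eq (integral_congr_ae (.of_forall fun ξ => ?_))
    simp
  have hL2 : MemLp (fun ξ => ‖𝓕 (f - Δ f) ξ‖) (ENNReal.ofReal 2) :=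
    ((𝓕 (f - Δ f) : 𝓢(E, ℂ)).memLp _).norm
  calc ‖f x‖ ≤ ∫ ξ, ‖𝓕 f ξ‖ := hx
    _ ≤ ∫ ξ, (1 + ‖ξ‖ ^ 2) ^ (-(1 : ℝ)) * ‖𝓕 (f - Δ f) ξ‖ := by
        refine integral_mono (𝓕 f).integrable.norm ?_ hF
        exact MemLp.integrable_mul (p := 2) (q := 2) (by simpa using hmem) (by simpa using hL2)
    _ ≤ _ := by
        -- Cauchy–Schwarz, then Plancherel for the second factor.
        refine (integral_mul_le_Lp_mul_Lq_of_nonneg Real.HolderConjugate.two_two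
          (.of_forall fun ξ => by simp only [Pi.zero_apply]; positivity)
          (.of_forall fun ξ => norm_nonneg _) hmem hL2).trans_eq ?_
        simp only [Real.rpow_two, ← Real.sqrt_eq_rpow]
        rw [SchwartzMap.integral_norm_sq_fourier]

/-- Complexification commutes with derivatives and preserves absolute values, so the Fourier
argument carries over to real functions. -/
theorem exists_abs_le_integral_sub_laplacian (hE : Module.finrank ℝ E < 4) :
    ∃ C : ℝ, 0 ≤ C ∧ ∀ (f : 𝓢(E, ℝ)) (x : E),
      |f x| ≤ C * √(∫ y, (f y - Δ f y) ^ 2) := by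
  obtain ⟨C, hC, h⟩ := exists_norm_le_integral_sub_laplacian hE
  refine ⟨C, hC, fun f x => ?_⟩
  set F : 𝓢(E, ℂ) := SchwartzMap.postcompCLM Complex.ofRealCLM f with hF
  have hd : ∀ (v : E) (g : 𝓢(E, ℝ)), ∂_{v} (SchwartzMap.postcompCLM Complex.ofRealCLM g) =
      SchwartzMap.postcompCLM Complex.ofRealCLM (∂_{v} g) := by
    intro v g
    ext y
    simp only [SchwartzMap.lineDerivOp_apply_eq_fderiv]
    have : (SchwartzMap.postcompCLM Complex.ofRealCLM g : E → ℂ) = Complex.ofRealCLM ∘ g := rfl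
    rw [this, Complex.ofRealCLM.hasFDerivAt.comp y g.differentiableAt.hasFDerivAt |>.fderiv]
    simp [SchwartzMap.lineDerivOp_apply_eq_fderiv]
  have hlap : Δ F = SchwartzMap.postcompCLM Complex.ofRealCLM (Δ f) := by
    simp only [SchwartzMap.laplacian_eq_sum (stdOrthonormalBasis ℝ E), hF, hd, map_sum]
  have := h F x
  rw [hlap, hF, ← map_sub] at this
  simpa [← Complex.ofReal_sub, Complex.norm_real] using this

/-- Two integrations by parts, with derivatives commuted in between; the two signs cancel. -/
theorem integral_lineDerivOp_sq_eq (f : 𝓢(E, ℝ)) (v w : E) :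
    ∫ x, (∂_{v} (∂_{w} f) x) ^ 2 = ∫ x, ∂_{v} (∂_{v} f) x * ∂_{w} (∂_{w} f) x := by
  simp_rw [sq]
  rw [SchwartzMap.integral_mul_lineDerivOp_right_eq_neg_left, lineDerivOp_comm f v w,
    lineDerivOp_comm (∂_{v} f) v w, eq_comm, SchwartzMap.integral_mul_lineDerivOp_right_eq_neg_left]

/-- A Calderón–Zygmund estimate in `L²`. -/
theorem integral_lineDerivOp_sq_le {ι : Type*} [Fintype ι] (b : OrthonormalBasis ι ℝ E)
    (f : 𝓢(E, ℝ)) (i j : ι) :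
    ∫ x, (∂_{b i} (∂_{b j} f) x) ^ 2 ≤ ∫ x, (Δ f x) ^ 2 := by
  have hint : ∀ g h : 𝓢(E, ℝ), Integrable fun x => g x * h x := fun g h =>
    MemLp.integrable_mul (p := 2) (q := 2) (g.memLp 2) (h.memLp 2)
  -- Expanding the square gives products of pure second derivatives, each of which integrates to the
  -- square of a mixed one.
  have h : ∫ x, (Δ f x) ^ 2 = ∑ k, ∑ l, ∫ x, (∂_{b k} (∂_{b l} f) x) ^ 2 := by
    simp_rw [integral_lineDerivOp_sq_eq, SchwartzMap.laplacian_eq_sum b, sum_apply, sq,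
      Finset.sum_mul_sum]
    rw [integral_finsetSum _ fun k _ => integrable_finsetSum _ fun l _ => hint _ _]
    exact Finset.sum_congr rfl fun k _ => integral_finsetSum _ fun l _ => hint _ _
  have h0 : ∀ k l, 0 ≤ ∫ x, (∂_{b k} (∂_{b l} f) x) ^ 2 := fun k l =>
    integral_nonneg fun x => sq_nonneg _
  rw [h]
  exact (Finset.single_le_sum (fun l _ => h0 i l) (Finset.mem_univ j)).trans
    (Finset.single_le_sum (f := fun k => ∑ l, ∫ x, (∂_{b k} (∂_{b l} f) x) ^ 2)
      (fun k _ => Finset.sum_nonneg fun l _ => h0 k l) (Finset.mem_univ i))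

/-- The Poincaré inequality. -/
theorem integral_sq_le_of_tsupport_subset_closedBall (f : 𝓢(E, ℝ)) {v : E} (hv : ‖v‖ = 1) {R : ℝ}
    (hf : tsupport f ⊆ Metric.closedBall 0 R) :
    ∫ x, (f x) ^ 2 ≤ (2 * R) ^ 2 * ∫ x, (∂_{v} f x) ^ 2 := by
  have hg : (inner ℝ · v : E → ℝ).HasTemperateGrowth := ((innerSL ℝ).flip v).hasTemperateGrowth
  have hint : ∀ g h : 𝓢(E, ℝ), Integrable fun x => g x * h x := fun g h =>
    MemLp.integrable_mul (p := 2) (q := 2) (g.memLp 2) (h.memLp 2)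
  -- As `∂_v ⟨x, v⟩ = 1`, integrating `⟨x, v⟩ f` by parts against `∂_v f` recovers `∫ f²`.
  set g : 𝓢(E, ℝ) := SchwartzMap.smulLeftCLM ℝ (inner ℝ · v) f with hgdef
  have hgx : ∀ x, g x = inner ℝ x v * f x := fun x => by
    rw [hgdef, SchwartzMap.smulLeftCLM_apply_apply hg, smul_eq_mul]
  have hdg : ∀ x, ∂_{v} g x = f x + inner ℝ x v * ∂_{v} f x := by
    intro x
    have h1 : HasFDerivAt (fun y : E => (innerSL ℝ).flip v y * f y) _ x :=
      ((innerSL ℝ).flip v).hasFDerivAt.mul f.differentiableAt.hasFDerivAt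
    have h2 : (g : E → ℝ) = fun y : E => (innerSL ℝ).flip v y * f y := funext hgx
    rw [SchwartzMap.lineDerivOp_apply_eq_fderiv, h2, h1.fderiv]
    simp [SchwartzMap.lineDerivOp_apply_eq_fderiv, innerSL_apply_apply ℝ, hv,
      real_inner_comm x v]
    ring
  have hparts := SchwartzMap.integral_mul_lineDerivOp_right_eq_neg_left (μ := volume) g f v
  have hR : ∀ x, |g x| ≤ R * |f x| := by
    intro x
    rw [hgx, abs_mul]
    by_cases hx : f x = 0
    · simp [hx]
    · have : ‖x‖ ≤ R := by simpa using hf (subset_tsupport _ hx)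
      refine mul_le_mul_of_nonneg_right ((abs_real_inner_le_norm x v).trans ?_) (abs_nonneg _)
      rwa [hv, mul_one]
  have key : ∫ x, (f x) ^ 2 = ∫ x, -2 * (g x * ∂_{v} f x) := by
    have h1 : ∫ x, ∂_{v} g x * f x = (∫ x, f x * f x) + ∫ x, g x * ∂_{v} f x := by
      rw [← integral_add (hint _ _) (hint _ _)]
      refine integral_congr_ae (.of_forall fun x => ?_)
      simp only [hdg, hgx]
      ring
    rw [integral_const_mul]
    simp_rw [sq]
    linarith
  have hle : ∫ x, (f x) ^ 2 ≤ ∫ x, ((1 / 2) * (f x * f x) +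
      (2 * R ^ 2) * (∂_{v} f x * ∂_{v} f x)) := by
    rw [key]
    refine integral_mono ((hint _ _).const_mul _)
      (((hint _ _).const_mul _).add ((hint _ _).const_mul _)) fun x => ?_
    have h1 : -(g x * ∂_{v} f x) ≤ R * |f x| * |∂_{v} f x| := by
      refine (neg_le_abs _).trans ?_
      rw [abs_mul]
      exact mul_le_mul_of_nonneg_right (hR x) (abs_nonneg _)
    -- Young's inequality with weight `1/2` on `f²`, which the left-hand side then absorbs.
    have h2 := sq_nonneg (|f x| - 2 * R * |∂_{v} f x|)
    have h3 := abs_mul_abs_self (f x)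
    have h4 := abs_mul_abs_self (∂_{v} f x)
    simp only
    rw [← h3, ← h4]
    nlinarith
  rw [integral_add ((hint _ _).const_mul _) ((hint _ _).const_mul _), integral_const_mul,
    integral_const_mul] at hle
  simp_rw [sq (f _), sq (∂_{v} f _)] at hle ⊢
  nlinarith

end Schwartz

/-! ### Estimates for test functions -/

/-- A test function as a Schwartz function. -/
def toSchwartz (φ : 𝓓(Ω, ℝ)) : 𝓢(EuclideanSpace ℝ (Fin d), ℝ) :=
  φ.hasCompactSupport.toSchwartzMap φ.contDiff

@[simp]
theorem toSchwartz_apply (φ : 𝓓(Ω, ℝ)) (x : EuclideanSpace ℝ (Fin d)) :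
    toSchwartz φ x = φ x := rfl

theorem toSchwartz_lineDerivOp (φ : 𝓓(Ω, ℝ)) (v : EuclideanSpace ℝ (Fin d)) :
    toSchwartz (∂_{v} φ) = ∂_{v} (toSchwartz φ) := by
  ext x
  rw [SchwartzMap.lineDerivOp_apply, toSchwartz_apply,
    TestFunction.lineDerivOp_eq_lineDerivCLM (𝕜 := ℝ),
    TestFunction.lineDerivCLM_apply_of_le (by simp)]
  rfl

/-- `ψ` is a derivative of order `n` of the test function `φ`. -/
inductive IsIterDeriv (φ : 𝓓(Ω, ℝ)) : ℕ → 𝓓(Ω, ℝ) → Prop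
  | zero : IsIterDeriv φ 0 φ
  | succ {n : ℕ} {ψ : 𝓓(Ω, ℝ)} (i : Fin d) (h : IsIterDeriv φ n ψ) :
      IsIterDeriv φ (n + 1) (∂_{EuclideanSpace.single i (1 : ℝ)} ψ)

theorem isIterDeriv_testDeriv (α : MultiIndex d m) (φ : 𝓓(Ω, ℝ)) :
    IsIterDeriv φ α.order (testDeriv α φ) := by
  have h : ∀ l : List (Fin d), IsIterDeriv φ (l.map fun i => (α.1 i : ℕ)).sum (l.foldr
      (fun i ψ => (fun χ : 𝓓(Ω, ℝ) => ∂_{EuclideanSpace.single i (1 : ℝ)} χ)^[(α.1 i : ℕ)] ψ)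
      φ) := by
    intro l
    induction l with
    | nil => exact .zero
    | cons i l ih =>
      rw [List.map_cons, List.sum_cons, List.foldr_cons]
      induction (α.1 i : ℕ) with
      | zero => simpa using ih
      | succ n ihn =>
        rw [Function.iterate_succ_apply', add_right_comm]
        exact ihn.succ i
  have := h (List.finRange d)
  rwa [← List.ofFn_eq_map, List.sum_ofFn] at this

theorem testDeriv_zero_index (φ : 𝓓(Ω, ℝ)) : testDeriv (MultiIndex.zero d m) φ = φ := by
  unfold testDeriv
  induction List.finRange d with
  | nil => rfl
  | cons i l ih => rw [List.foldr_cons, ih]; rfl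

theorem testDeriv_twice (i : Fin d) (φ : 𝓓(Ω, ℝ)) :
    testDeriv (MultiIndex.twice i) φ =
      ∂_{EuclideanSpace.single i (1 : ℝ)} (∂_{EuclideanSpace.single i (1 : ℝ)} φ) := by
  -- For induction the list is arbitrary: each occurrence of `i` contributes two derivatives, and
  -- `List.finRange d` contains it once.
  have h : ∀ l : List (Fin d), l.foldr (fun j ψ => (fun χ : 𝓓(Ω, ℝ) =>
      ∂_{EuclideanSpace.single j (1 : ℝ)} χ)^[((MultiIndex.twice i).1 j : ℕ)] ψ) φ =
      (fun χ : 𝓓(Ω, ℝ) => ∂_{EuclideanSpace.single i (1 : ℝ)} χ)^[2 * l.count i] φ := by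
    intro l
    induction l with
    | nil => rfl
    | cons j l ih =>
      rw [List.foldr_cons, ih]
      by_cases hj : j = i
      · subst hj
        rw [List.count_cons_self, mul_add, add_comm (2 * _), Function.iterate_add_apply]
        simp [MultiIndex.twice]
      · rw [List.count_cons_of_ne hj]
        simp [MultiIndex.twice, Pi.single_eq_of_ne hj]
  rw [testDeriv, h, List.count_eq_one_of_mem (List.nodup_finRange d) (List.mem_finRange i)]
  rfl

theorem laplacian_toSchwartz_apply (φ : 𝓓(Ω, ℝ)) (x : EuclideanSpace ℝ (Fin d)) :
    Δ (toSchwartz φ) x = ∑ i, testDeriv (MultiIndex.twice i) φ x := by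
  simp_rw [SchwartzMap.laplacian_eq_sum (EuclideanSpace.basisFun (Fin d) ℝ), sum_apply,
    testDeriv_twice, EuclideanSpace.basisFun_apply, ← toSchwartz_lineDerivOp, toSchwartz_apply]

/-- Order two is the `L²` Calderón–Zygmund bound; each missing order costs one Poincaré inequality
along the first axis, hence a factor `(2R)²`. -/
theorem integral_sq_le_of_isIterDeriv [NeZero d] {R : ℝ}
    (hR : (Ω : Set (EuclideanSpace ℝ (Fin d))) ⊆ Metric.closedBall 0 R)
    {n : ℕ} (hn : n ≤ 2) {φ ψ : 𝓓(Ω, ℝ)} (h : IsIterDeriv φ n ψ) :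
    ∫ x, (ψ x) ^ 2 ≤ ((2 * R) ^ 2) ^ (2 - n) * ∫ x, (Δ (toSchwartz φ) x) ^ 2 := by
  have step : ∀ χ : 𝓓(Ω, ℝ), ∫ x, (χ x) ^ 2 ≤
      (2 * R) ^ 2 * ∫ x, ((∂_{EuclideanSpace.single (0 : Fin d) (1 : ℝ)} χ : 𝓓(Ω, ℝ)) x) ^ 2 := by
    intro χ
    have := integral_sq_le_of_tsupport_subset_closedBall (toSchwartz χ)
      (v := EuclideanSpace.single (0 : Fin d) (1 : ℝ)) (by simp) (χ.tsupport_subset.trans hR)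
    rwa [← toSchwartz_lineDerivOp] at this
  have two : ∀ {χ : 𝓓(Ω, ℝ)}, IsIterDeriv φ 2 χ →
      ∫ x, (χ x) ^ 2 ≤ ∫ x, (Δ (toSchwartz φ) x) ^ 2 := by
    rintro _ (_ | ⟨i, (_ | ⟨j, (_ | _)⟩)⟩)
    have := integral_lineDerivOp_sq_le (EuclideanSpace.basisFun (Fin d) ℝ) (toSchwartz φ) i j
    simpa only [EuclideanSpace.basisFun_apply, ← toSchwartz_lineDerivOp, toSchwartz_apply]
      using this
  have one : ∀ {χ : 𝓓(Ω, ℝ)}, IsIterDeriv φ 1 χ →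
      ∫ x, (χ x) ^ 2 ≤ (2 * R) ^ 2 * ∫ x, (Δ (toSchwartz φ) x) ^ 2 := fun {χ} hχ =>
    (step χ).trans (mul_le_mul_of_nonneg_left (two (hχ.succ 0)) (sq_nonneg _))
  interval_cases n
  · rw [pow_two, mul_assoc]
    exact (step ψ).trans (mul_le_mul_of_nonneg_left (one (h.succ 0)) (sq_nonneg _))
  · simpa using one h
  · simpa using two h

theorem L2.norm_sq_eq_integral (u : L2 Ω) : ‖u‖ ^ 2 = ∫ x in Ω, (u x) ^ 2 := by
  rw [← real_inner_self_eq_norm_sq, MeasureTheory.L2.inner_def]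
  simp [sq]

theorem L2.norm_sq_eq_integral_of_ae_eq {u : L2 Ω} {g : EuclideanSpace ℝ (Fin d) → ℝ}
    (hu : u =ᵐ[volume.restrict (Ω : Set (EuclideanSpace ℝ (Fin d)))] g)
    (hg : ∀ x ∉ Ω, g x = 0) : ‖u‖ ^ 2 = ∫ x, (g x) ^ 2 := by
  have h : ∫ x in Ω, (g x) ^ 2 = ∫ x, (g x) ^ 2 :=
    setIntegral_eq_integral_of_forall_compl_eq_zero fun x hx => by
      rw [hg x hx, zero_pow two_ne_zero]
  rw [L2.norm_sq_eq_integral, ← h]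
  exact integral_congr_ae (hu.mono fun x hx => congrArg (· ^ 2) hx)

theorem testFunction_eq_zero (φ : 𝓓(Ω, ℝ)) {x : EuclideanSpace ℝ (Fin d)} (hx : x ∉ Ω) :
    φ x = 0 :=
  image_eq_zero_of_notMem_tsupport fun h => hx (φ.tsupport_subset h)

theorem laplacian_toSchwartz_eq_zero (φ : 𝓓(Ω, ℝ)) {x : EuclideanSpace ℝ (Fin d)} (hx : x ∉ Ω) :
    Δ (toSchwartz φ) x = 0 := by
  rw [laplacian_toSchwartz_apply]
  exact Finset.sum_eq_zero fun i _ => testFunction_eq_zero _ hx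

/-! ### Coercivity, sup bound and completeness for `H0` -/

/-- The weak derivative `D^α : H^m(Ω) → L²(Ω)` as a continuous linear map. -/
def H.derivCLM (α : MultiIndex d m) : H m Ω →L[ℝ] L2 Ω :=
  (PiLp.proj 2 (fun _ : MultiIndex d m => L2 Ω) α).comp (H m Ω).subtypeL

/-- The Laplacian `H²(Ω) → L²(Ω)` as a continuous linear map. -/
def H.laplacianCLM : H 2 Ω →L[ℝ] L2 Ω := ∑ i : Fin d, H.derivCLM (MultiIndex.twice i)

@[simp]
theorem H.laplacianCLM_apply (u : H 2 Ω) : H.laplacianCLM u = H.laplacian u := by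
  simp [H.laplacianCLM, H.laplacian, H.derivCLM, H.deriv]

theorem H.laplacian_ae_eq {u : H 2 Ω} {φ : 𝓓(Ω, ℝ)} (h : ∀ α, H.deriv α u
    =ᵐ[volume.restrict (Ω : Set (EuclideanSpace ℝ (Fin d)))] testDeriv α φ) :
    H.laplacian u =ᵐ[volume.restrict (Ω : Set (EuclideanSpace ℝ (Fin d)))]
      (Δ (toSchwartz φ) : 𝓢(EuclideanSpace ℝ (Fin d), ℝ)) := by
  have h1 : ∀ᵐ x ∂volume.restrict (Ω : Set (EuclideanSpace ℝ (Fin d))),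
      ∀ i, H.deriv (MultiIndex.twice i) u x = testDeriv (MultiIndex.twice i) φ x :=
    ae_all_iff.2 fun i => h _
  filter_upwards [h1, Lp.coeFn_fun_finsetSum Finset.univ
    fun i => H.deriv (MultiIndex.twice i) u] with x hx hs
  rw [laplacian_toSchwartz_apply, H.laplacian, hs]
  exact Finset.sum_congr rfl fun i _ => hx i

/-- Density reduces any closed condition on `H0` to test functions. -/
theorem mem_of_mem_H0 {s : Set (H m Ω)} (hs : IsClosed s)
    (h : ∀ (u : H m Ω) (φ : 𝓓(Ω, ℝ)), (∀ α, H.deriv α u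
      =ᵐ[volume.restrict (Ω : Set (EuclideanSpace ℝ (Fin d)))] testDeriv α φ) → u ∈ s)
    {u : H m Ω} (hu : u ∈ H0 m Ω) : u ∈ s := by
  have hsub : (testSubspace m Ω : Set (H m Ω)) ⊆ s := fun w ⟨φ, hφ⟩ => h w φ hφ
  exact closure_minimal hsub hs hu

theorem exists_norm_sq_le_norm_laplacian_sq [NeZero d]
    (hΩ : Bornology.IsBounded (Ω : Set (EuclideanSpace ℝ (Fin d)))) :
    ∃ K : ℝ, 0 < K ∧ ∀ u ∈ H0 2 Ω, ‖u‖ ^ 2 ≤ K * ‖H.laplacian u‖ ^ 2 := by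
  obtain ⟨R, hR⟩ := hΩ.subset_closedBall 0
  -- The added `1` makes positivity of the constant immediate.
  refine ⟨(∑ α : MultiIndex d 2, ((2 * R) ^ 2) ^ (2 - α.order)) + 1, by positivity,
    fun u hu => ?_⟩
  refine mem_of_mem_H0 (s := {u : H 2 Ω | ‖u‖ ^ 2 ≤
    ((∑ α : MultiIndex d 2, ((2 * R) ^ 2) ^ (2 - α.order)) + 1) * ‖H.laplacian u‖ ^ 2})
    ?_ ?_ hu
  · simp_rw [← H.laplacianCLM_apply]
    exact isClosed_le (by fun_prop) (by fun_prop)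
  · intro w φ h
    have h2 : ‖w‖ ^ 2 = ∑ α, ‖H.deriv α w‖ ^ 2 := PiLp.norm_sq_eq_of_L2 _ w.1
    have hle : ∀ α : MultiIndex d 2, ‖H.deriv α w‖ ^ 2 ≤
        ((2 * R) ^ 2) ^ (2 - α.order) * ‖H.laplacian w‖ ^ 2 := by
      intro α
      rw [L2.norm_sq_eq_integral_of_ae_eq (h α) fun x hx => testFunction_eq_zero _ hx,
        L2.norm_sq_eq_integral_of_ae_eq (H.laplacian_ae_eq h)
          fun x hx => laplacian_toSchwartz_eq_zero φ hx]
      exact integral_sq_le_of_isIterDeriv hR α.2 (isIterDeriv_testDeriv α φ)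
    rw [Set.mem_ofPred_eq, h2, add_mul, Finset.sum_mul, one_mul]
    exact (Finset.sum_le_sum fun α _ => hle α).trans (le_add_of_nonneg_right (sq_nonneg _))

theorem exists_ae_abs_toL2_le (hd : d < 4) :
    ∃ C : ℝ, 0 ≤ C ∧ ∀ u ∈ H0 2 Ω,
      ∀ᵐ x ∂volume.restrict (Ω : Set (EuclideanSpace ℝ (Fin d))), |H.toL2 u x| ≤ C * ‖u‖ := by
  obtain ⟨C, hC, hS⟩ := exists_abs_le_integral_sub_laplacian
    (E := EuclideanSpace ℝ (Fin d)) (by simpa using hd)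
  set T : H 2 Ω →L[ℝ] L2 Ω := H.derivCLM (MultiIndex.zero d 2) - H.laplacianCLM with hT
  refine ⟨C * ‖T‖, by positivity, fun u hu => ?_⟩
  have key : u ∈ {u : H 2 Ω | ∀ᵐ x ∂volume.restrict (Ω : Set (EuclideanSpace ℝ (Fin d))),
      |H.toL2 u x| ≤ C * ‖T u‖} := by
    refine mem_of_mem_H0 ?_ ?_ hu
    -- The pointwise bound survives `L²` limits because a subsequence converges almost everywhere.
    · refine IsSeqClosed.isClosed fun w u hw hlim => ?_
      have h1 : Filter.Tendsto (fun n => H.toL2 (w n)) Filter.atTop (nhds (H.toL2 u)) :=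
        ((H.derivCLM (MultiIndex.zero d 2)).continuous.tendsto u).comp hlim
      obtain ⟨ns, hns, hae⟩ :=
        (tendstoInMeasure_of_tendsto_Lp h1).exists_seq_tendsto_ae
      filter_upwards [hae, ae_all_iff.2 hw] with x hx hb
      refine le_of_tendsto_of_tendsto hx.abs
        (((T.continuous.tendsto u).comp (hlim.comp hns.tendsto_atTop)).norm.const_mul C)
        (.of_forall fun n => hb (ns n))
    · intro w φ h
      have h0 : H.toL2 w =ᵐ[volume.restrict (Ω : Set (EuclideanSpace ℝ (Fin d)))] φ := by
        have := h (MultiIndex.zero d 2)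
        rwa [testDeriv_zero_index] at this
      have hTw : T w =ᵐ[volume.restrict (Ω : Set (EuclideanSpace ℝ (Fin d)))]
          fun x => toSchwartz φ x - Δ (toSchwartz φ) x := by
        have : T w = H.toL2 w - H.laplacian w := by
          simp only [hT, sub_apply, H.laplacianCLM_apply]
          rfl
        rw [this]
        filter_upwards [h0, H.laplacian_ae_eq h, Lp.coeFn_sub (H.toL2 w) (H.laplacian w)]
          with x h1 h2 h3
        rw [h3, Pi.sub_apply, h1, h2, toSchwartz_apply]
      have hn := L2.norm_sq_eq_integral_of_ae_eq hTw fun x hx => by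
        rw [laplacian_toSchwartz_eq_zero φ hx, toSchwartz_apply, testFunction_eq_zero φ hx,
          sub_zero]
      filter_upwards [h0] with x hx
      rw [hx, ← Real.sqrt_sq (norm_nonneg (T w)), hn]
      exact hS (toSchwartz φ) x
  filter_upwards [key] with x hx
  rw [mul_assoc]
  exact hx.trans (mul_le_mul_of_nonneg_left (T.le_opNorm u) hC)

/-- Pairing with a test function is an `L²` inner product, so each defining identity of a weak
derivative is a closed condition. -/
theorem isClosed_H : IsClosed (H m Ω : Set (PiLp 2 (fun _ : MultiIndex d m => L2 Ω))) := by
  have hcont : ∀ (α : MultiIndex d m) (φ : 𝓓(Ω, ℝ)), Continuous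
      fun U : PiLp 2 (fun _ : MultiIndex d m => L2 Ω) => ∫ x in Ω, U α x * φ x := by
    intro α φ
    have hφ : MemLp φ 2 (volume.restrict (Ω : Set (EuclideanSpace ℝ (Fin d)))) :=
      φ.continuous.memLp_of_hasCompactSupport φ.hasCompactSupport
    have h : ∀ g : L2 Ω, ∫ x in Ω, g x * φ x = inner ℝ (hφ.toLp φ) g := by
      intro g
      rw [MeasureTheory.L2.inner_def]
      refine integral_congr_ae ?_
      filter_upwards [hφ.coeFn_toLp] with x hx
      simp [hx]
    simp_rw [h]
    fun_prop
  have : (H m Ω : Set (PiLp 2 (fun _ : MultiIndex d m => L2 Ω))) =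
      ⋂ (α : MultiIndex d m) (φ : 𝓓(Ω, ℝ)), {U | ∫ x in Ω, U (MultiIndex.zero d m) x *
        testDeriv α φ x = (-1 : ℝ) ^ α.order * ∫ x in Ω, U α x * φ x} := by
    ext U
    simp only [Set.mem_iInter]
    rfl
  rw [this]
  exact isClosed_iInter fun α => isClosed_iInter fun φ =>
    isClosed_eq (hcont _ _) ((hcont _ _).const_mul _)

instance : CompleteSpace (H m Ω) := isClosed_H.completeSpace_coe

instance : CompleteSpace (H0 m Ω) :=
  (testSubspace m Ω).isClosed_topologicalClosure.completeSpace_coe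

/-! ### Zeros of strongly monotone operators -/

/-- Zarantonello's theorem: a strongly monotone Lipschitz operator on a Hilbert space has a zero. -/
theorem exists_eq_zero_of_strongly_monotone {V : Type*} [NormedAddCommGroup V]
    [InnerProductSpace ℝ V] [CompleteSpace V] {A : V → V} {L : ℝ≥0} {c : ℝ} (hc : 0 < c)
    (hL : LipschitzWith L A) (hA : ∀ u v, c * ‖u - v‖ ^ 2 ≤ inner ℝ (A u - A v) (u - v)) :
    ∃ u, A u = 0 := by
  -- `M` is a Lipschitz constant that is also at least `c`, so that `1 - c²/M²` is nonnegative.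
  set M : ℝ := L + c with hM
  have hMpos : 0 < M := by positivity
  have hq : (0 : ℝ) ≤ 1 - c ^ 2 / M ^ 2 := by
    rw [sub_nonneg, div_le_one (by positivity)]
    have : c ≤ M := by rw [hM]; linarith [L.coe_nonneg]
    exact pow_le_pow_left₀ hc.le this 2
  set k : ℝ≥0 := ⟨√(1 - c ^ 2 / M ^ 2), Real.sqrt_nonneg _⟩ with hk
  -- The step `t = c/M²` minimises the bound `1 - 2tc + t²M²` on the squared contraction factor.
  have hcontr : ContractingWith k fun u => u - (c / M ^ 2) • A u := by
    refine ⟨?_, LipschitzWith.of_dist_le_mul fun u v => ?_⟩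
    · rw [← NNReal.coe_lt_coe, hk]
      change √_ < 1
      rw [Real.sqrt_lt' one_pos]
      have : 0 < c ^ 2 / M ^ 2 := by positivity
      linarith
    · rw [dist_eq_norm, dist_eq_norm]
      have h1 : ‖A u - A v‖ ≤ M * ‖u - v‖ := by
        have := hL.dist_le_mul u v
        rw [dist_eq_norm, dist_eq_norm] at this
        refine this.trans (mul_le_mul_of_nonneg_right ?_ (norm_nonneg _))
        rw [hM]
        linarith
      have h2 : ‖u - (c / M ^ 2) • A u - (v - (c / M ^ 2) • A v)‖ ^ 2 ≤
          (1 - c ^ 2 / M ^ 2) * ‖u - v‖ ^ 2 := by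
        have e : u - (c / M ^ 2) • A u - (v - (c / M ^ 2) • A v) =
            (u - v) - (c / M ^ 2) • (A u - A v) := by
          rw [smul_sub]
          abel
        rw [e, norm_sub_sq_real, inner_smul_right, real_inner_comm, norm_smul, mul_pow,
          Real.norm_of_nonneg (by positivity)]
        have h3 : ‖A u - A v‖ ^ 2 ≤ M ^ 2 * ‖u - v‖ ^ 2 := by
          rw [← mul_pow]
          exact pow_le_pow_left₀ (norm_nonneg _) h1 2
        have h4 := mul_le_mul_of_nonneg_left (hA u v) (by positivity : 0 ≤ c / M ^ 2)
        have h5 := mul_le_mul_of_nonneg_left h3 (by positivity : 0 ≤ (c / M ^ 2) ^ 2)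
        have h6 : (c / M ^ 2) ^ 2 * (M ^ 2 * ‖u - v‖ ^ 2) = c ^ 2 / M ^ 2 * ‖u - v‖ ^ 2 := by
          field_simp
        have h7 : c / M ^ 2 * (c * ‖u - v‖ ^ 2) = c ^ 2 / M ^ 2 * ‖u - v‖ ^ 2 := by
          field_simp
        rw [h6] at h5
        rw [h7] at h4
        linarith
      change _ ≤ √(1 - c ^ 2 / M ^ 2) * ‖u - v‖
      refine le_of_sq_le_sq ?_ (by positivity)
      rwa [mul_pow, Real.sq_sqrt hq]
  refine ⟨hcontr.fixedPoint, ?_⟩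
  have h : hcontr.fixedPoint - (c / M ^ 2) • A hcontr.fixedPoint = hcontr.fixedPoint :=
    hcontr.fixedPoint_isFixedPt
  rw [sub_eq_self, smul_eq_zero] at h
  exact h.resolve_left (by positivity)

/-! ### The truncated nonlinearity -/

/-- The power `s ↦ s ^ q`, truncated to `[0, M]`. -/
def truncPow (M q s : ℝ) : ℝ := (max 0 (min M s)) ^ q

theorem monotone_truncPow (M : ℝ) {q : ℝ} (hq : 0 ≤ q) : Monotone (truncPow M q) := fun _ _ h =>
  Real.rpow_le_rpow (le_max_left _ _) (max_le_max_left _ (min_le_min_left _ h)) hq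

/-- Clamping is 1-Lipschitz, and for `q ≥ 1` the derivative of the power on `[0, M]` is at most `q
M^(q-1)`. -/
theorem exists_lipschitzWith_truncPow {M q : ℝ} (hM : 0 ≤ M) (hq : 1 ≤ q) :
    ∃ L : ℝ≥0, LipschitzWith L (truncPow M q) := by
  set L : ℝ≥0 := ⟨q * M ^ (q - 1), by positivity⟩ with hL
  have h1 : LipschitzOnWith L (fun s : ℝ => s ^ q) (Set.Icc 0 M) := by
    refine (convex_Icc 0 M).lipschitzOnWith_of_nnnorm_hasDerivWithin_le
      (f' := fun s => q * s ^ (q - 1))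
      (fun s _ => (Real.hasDerivAt_rpow_const (Or.inr hq)).hasDerivWithinAt) fun s hs => ?_
    rw [← NNReal.coe_le_coe, coe_nnnorm, Real.norm_of_nonneg
      (mul_nonneg (by linarith) (Real.rpow_nonneg hs.1 _))]
    exact mul_le_mul_of_nonneg_left (Real.rpow_le_rpow hs.1 hs.2 (by linarith)) (by linarith)
  have h2 : LipschitzWith 1 fun s : ℝ => max 0 (min M s) :=
    (LipschitzWith.id.const_min M).const_max 0
  refine ⟨L * 1, lipschitzOnWith_univ.1 (h1.comp (h2.lipschitzOnWith (s := Set.univ))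
    fun s _ => ⟨le_max_left _ _, max_le hM (min_le_left _ _)⟩)⟩

/-- The odd power `s ↦ |s| ^ (q - 1) * s`, truncated to `[-M, M]`. -/
def truncOddPow (M q s : ℝ) : ℝ := truncPow M q s - truncPow M q (-s)

theorem monotone_truncOddPow (M : ℝ) {q : ℝ} (hq : 0 ≤ q) : Monotone (truncOddPow M q) :=
  fun _ _ h => sub_le_sub (monotone_truncPow M hq h) (monotone_truncPow M hq (neg_le_neg h))

theorem exists_lipschitzWith_truncOddPow {M q : ℝ} (hM : 0 ≤ M) (hq : 1 ≤ q) :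
    ∃ L : ℝ≥0, LipschitzWith L (truncOddPow M q) := by
  obtain ⟨L, hL⟩ := exists_lipschitzWith_truncPow hM hq
  exact ⟨L + L * 1, hL.sub (hL.comp LipschitzWith.id.neg)⟩

theorem truncOddPow_zero (M q : ℝ) : truncOddPow M q 0 = 0 := by
  simp [truncOddPow]

theorem truncOddPow_of_abs_le {M r s : ℝ} (hr : 0 < r) (hs : |s| ≤ M) :
    truncOddPow M (r + 1) s = |s| ^ r * s := by
  have h := abs_le.1 hs
  unfold truncOddPow truncPow
  rw [min_eq_right h.2, min_eq_right (by linarith)]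
  rcases le_total 0 s with h0 | h0
  · rw [max_eq_right h0, max_eq_left (by linarith), abs_of_nonneg h0,
      Real.zero_rpow (by linarith), sub_zero, Real.rpow_add_one' h0 (by linarith)]
  · rw [max_eq_left h0, max_eq_right (by linarith), abs_of_nonpos h0,
      Real.zero_rpow (by linarith), Real.rpow_add_one' (by linarith) (by linarith)]
    ring

/-! ### The abstract semilinear equation -/

section Hilbert

variable {X V F : Type*} [MeasurableSpace X] {μ : Measure X}
  [NormedAddCommGroup V] [InnerProductSpace ℝ V] [CompleteSpace V]
  [NormedAddCommGroup F] [InnerProductSpace ℝ F] [CompleteSpace F]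

/-- The operator `u ↦ D* D u + λ T* g(T u) - f`, where the functional `f` is identified with an
element of `V` by the Riesz isomorphism. -/
def semilinearOperator (D : V →L[ℝ] F) (T : V →L[ℝ] Lp ℝ 2 μ) (lam : ℝ) {L : ℝ≥0} {g : ℝ → ℝ}
    (hg : LipschitzWith L g) (g0 : g 0 = 0) (f : StrongDual ℝ V) (u : V) : V :=
  D.adjoint (D u) + lam • T.adjoint (hg.compLp g0 (T u)) - (InnerProductSpace.toDual ℝ V).symm f

variable (D : V →L[ℝ] F) (T : V →L[ℝ] Lp ℝ 2 μ) (lam : ℝ) {L : ℝ≥0} {g : ℝ → ℝ}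
  (hg : LipschitzWith L g) (g0 : g 0 = 0) (f : StrongDual ℝ V)

theorem inner_semilinearOperator (u v : V) :
    inner ℝ (semilinearOperator D T lam hg g0 f u) v =
      inner ℝ (D u) (D v) + lam * inner ℝ (hg.compLp g0 (T u)) (T v) - f v := by
  rw [semilinearOperator, inner_sub_left, inner_add_left, inner_smul_left,
    ContinuousLinearMap.adjoint_inner_left, ContinuousLinearMap.adjoint_inner_left,
    InnerProductSpace.toDual_symm_apply, conj_trivial]

theorem exists_lipschitzWith_semilinearOperator :
    ∃ K : ℝ≥0, LipschitzWith K (semilinearOperator D T lam hg g0 f) := by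
  have h1 := D.adjoint.lipschitz.comp D.lipschitz
  have h2 := T.adjoint.lipschitz.comp ((hg.lipschitzWith_compLp g0 (p := 2)).comp T.lipschitz)
  exact ⟨_, (h1.add ((lipschitzWith_smul lam).comp h2)).sub
    (LipschitzWith.const ((InnerProductSpace.toDual ℝ V).symm f))⟩

theorem inner_compLp_sub_nonneg (hmono : Monotone g) (u v : Lp ℝ 2 μ) :
    0 ≤ inner ℝ (hg.compLp g0 u - hg.compLp g0 v) (u - v) := by
  rw [MeasureTheory.L2.inner_def]
  refine integral_nonneg_of_ae ?_
  filter_upwards [Lp.coeFn_sub (hg.compLp g0 u) (hg.compLp g0 v), Lp.coeFn_sub u v,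
    hg.coeFn_compLp g0 u, hg.coeFn_compLp g0 v] with x h1 h2 h3 h4
  simp only [h1, h2, h3, h4, Pi.sub_apply, Function.comp_apply, Pi.zero_apply,
    RCLike.inner_apply, conj_trivial]
  rcases le_total (u x) (v x) with h | h
  · exact mul_nonneg_of_nonpos_of_nonpos (by linarith) (by linarith [hmono h])
  · exact mul_nonneg (by linarith) (by linarith [hmono h])

variable {lam} in
theorem norm_sub_sq_le_inner_semilinearOperator (hlam : 0 ≤ lam) (hmono : Monotone g) (u v : V) :
    ‖D (u - v)‖ ^ 2 ≤ inner ℝ (semilinearOperator D T lam hg g0 f u -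
      semilinearOperator D T lam hg g0 f v) (u - v) := by
  have h1 := inner_compLp_sub_nonneg hg g0 hmono (T u) (T v)
  have h2 : inner ℝ (D u) (D (u - v)) - inner ℝ (D v) (D (u - v)) = ‖D (u - v)‖ ^ 2 := by
    rw [← inner_sub_left, ← map_sub, real_inner_self_eq_norm_sq]
  rw [← map_sub, inner_sub_left] at h1
  rw [inner_sub_left, inner_semilinearOperator, inner_semilinearOperator]
  linarith [mul_nonneg hlam h1]

variable {D T lam f} in
-- Truncation is invisible where `|T u| ≤ M`. The level is left free because existence and
-- uniqueness call for different ones.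
theorem forall_eq_iff_semilinearOperator_eq_zero {r M : ℝ} (hr : 0 < r)
    (hg : LipschitzWith L (truncOddPow M (r + 1))) {u : V} (hu : ∀ᵐ x ∂μ, |T u x| ≤ M) :
    (∀ v, inner ℝ (D u) (D v) + lam * ∫ x, |T u x| ^ r * T u x * T v x ∂μ = f v) ↔
      semilinearOperator D T lam hg (truncOddPow_zero _ _) f u = 0 := by
  have h : ∀ v, ∫ x, |T u x| ^ r * T u x * T v x ∂μ =
      inner ℝ (hg.compLp (truncOddPow_zero _ _) (T u)) (T v) := by
    intro v
    rw [MeasureTheory.L2.inner_def]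
    refine integral_congr_ae ?_
    filter_upwards [hu, hg.coeFn_compLp (truncOddPow_zero _ _) (T u)] with x hx hc
    rw [hc, Function.comp_apply, truncOddPow_of_abs_le hr hx, RCLike.inner_apply, conj_trivial,
      mul_comm]
  constructor
  · intro H
    refine ext_inner_right ℝ fun v => ?_
    rw [inner_semilinearOperator, inner_zero_left, ← h, H, sub_self]
  · intro H v
    rw [h, ← sub_eq_zero, ← inner_semilinearOperator, H, inner_zero_left]

variable {D T lam} in
/-- Existence and uniqueness for the weak form of `D* D u + λ T* (|T u| ^ r T u) = f`, when `D` is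
coercive and `T` takes values in `L^∞`. -/
theorem existsUnique_forall_inner_add_integral_eq {K C r : ℝ} (hK : 0 < K) (hC : 0 ≤ C)
    (hlam : 0 ≤ lam) (hr : 0 < r) (hD : ∀ u, ‖u‖ ^ 2 ≤ K * ‖D u‖ ^ 2)
    (hT : ∀ u, ∀ᵐ x ∂μ, |T u x| ≤ C * ‖u‖) :
    ∃! u, ∀ v, inner ℝ (D u) (D v) + lam * ∫ x, |T u x| ^ r * T u x * T v x ∂μ = f v := by
  have hmon : ∀ {M : ℝ} {L : ℝ≥0} (hg : LipschitzWith L (truncOddPow M (r + 1))) (u v : V),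
      K⁻¹ * ‖u - v‖ ^ 2 ≤ inner ℝ (semilinearOperator D T lam hg (truncOddPow_zero _ _) f u -
        semilinearOperator D T lam hg (truncOddPow_zero _ _) f v) (u - v) := by
    intro M L hg u v
    refine le_trans ?_ (norm_sub_sq_le_inner_semilinearOperator D T hg _ f hlam
      (monotone_truncOddPow M (by positivity)) u v)
    rw [inv_mul_le_iff₀ hK]
    exact hD (u - v)
  have hbound : ∀ {M : ℝ} (u : V), C * ‖u‖ ≤ M → ∀ᵐ x ∂μ, |T u x| ≤ M :=
    fun u hu => (hT u).mono fun x hx => hx.trans hu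
  refine existsUnique_of_exists_of_unique ?_ fun u v hu hv => ?_
  -- `K ‖f‖` is the a priori bound on the zero's norm, and `C` turns it into a sup bound.
  · obtain ⟨L, hg⟩ := exists_lipschitzWith_truncOddPow (M := C * (K * ‖f‖)) (q := r + 1)
      (by positivity) (by linarith)
    obtain ⟨L', hL'⟩ := exists_lipschitzWith_semilinearOperator D T lam hg (truncOddPow_zero _ _) f
    obtain ⟨u, hu⟩ := exists_eq_zero_of_strongly_monotone (inv_pos.2 hK) hL' (hmon hg)
    refine ⟨u, (forall_eq_iff_semilinearOperator_eq_zero hr hg (hbound u ?_)).2 hu⟩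
    refine mul_le_mul_of_nonneg_left ?_ hC
    -- Comparison with `0`, where the nonlinearity vanishes, gives `‖u‖² ≤ K f(u)` whatever the
    -- truncation level.
    have h1 := hmon hg u 0
    rw [inner_sub_left, hu, inner_zero_left, inner_semilinearOperator, map_zero, map_zero,
      LipschitzWith.compLp_zero, inner_zero_left, inner_zero_left, sub_zero,
      inv_mul_le_iff₀ hK] at h1
    have h2 : f u ≤ ‖f‖ * ‖u‖ := (le_abs_self _).trans (f.le_opNorm u)
    rcases (norm_nonneg u).eq_or_lt with h | h
    · rw [← h]
      positivity
    · refine le_of_mul_le_mul_right ?_ h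
      nlinarith [mul_le_mul_of_nonneg_left h2 hK.le]
  · obtain ⟨L, hg⟩ := exists_lipschitzWith_truncOddPow (M := max (C * ‖u‖) (C * ‖v‖))
      (q := r + 1) (by positivity) (by linarith)
    have h := hmon hg u v
    rw [(forall_eq_iff_semilinearOperator_eq_zero hr hg (hbound u (le_max_left _ _))).1 hu,
      (forall_eq_iff_semilinearOperator_eq_zero hr hg (hbound v (le_max_right _ _))).1 hv,
      sub_zero, inner_zero_left, inv_mul_le_iff₀ hK, mul_zero] at h
    exact sub_eq_zero.1 (norm_eq_zero.1 (pow_eq_zero_iff two_ne_zero |>.1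
      (le_antisymm h (sq_nonneg _))))

end Hilbert

/-! ### Application to the plate problem -/

/-- A bounded factor times `v`, which is integrable since `Ω` has finite measure. -/
theorem integrableOn_abs_rpow_mul (hΩ : Bornology.IsBounded (Ω : Set (EuclideanSpace ℝ (Fin d))))
    {r M : ℝ} (hr : 0 ≤ r) {u v : L2 Ω}
    (hu : ∀ᵐ x ∂volume.restrict (Ω : Set (EuclideanSpace ℝ (Fin d))), |u x| ≤ M) :
    IntegrableOn (fun x => |u x| ^ r * u x * v x) (Ω : Set (EuclideanSpace ℝ (Fin d))) := by
  have : IsFiniteMeasure (volume.restrict (Ω : Set (EuclideanSpace ℝ (Fin d)))) :=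
    isFiniteMeasure_restrict.2 hΩ.measure_lt_top.ne
  refine ((Lp.memLp v).integrable one_le_two).bdd_mul (c := M ^ r * M) ?_ ?_
  · exact (((Lp.stronglyMeasurable u).measurable.abs.pow_const r).mul
      (Lp.stronglyMeasurable u).measurable).aestronglyMeasurable
  · filter_upwards [hu] with x hx
    rw [norm_mul, Real.norm_of_nonneg (by positivity), Real.norm_eq_abs]
    exact mul_le_mul (Real.rpow_le_rpow (abs_nonneg _) hx hr) hx (abs_nonneg _)
      (Real.rpow_nonneg ((abs_nonneg _).trans hx) _)

/-- The embedding `H₀²(Ω) → L²(Ω)`. -/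
def H0.toL2CLM : H0 m Ω →L[ℝ] L2 Ω :=
  (H.derivCLM (MultiIndex.zero d m)).comp (H0 m Ω).subtypeL

theorem H0.toL2CLM_apply (u : H0 m Ω) : H0.toL2CLM u = H.toL2 u.1 := rfl

/-- The Laplacian `H₀²(Ω) → L²(Ω)`. -/
def H0.laplacianCLM : H0 2 Ω →L[ℝ] L2 Ω := H.laplacianCLM.comp (H0 2 Ω).subtypeL

theorem H0.laplacianCLM_apply (u : H0 2 Ω) : H0.laplacianCLM u = H.laplacian u.1 :=
  H.laplacianCLM_apply u.1

theorem existsUnique_isWeakSolution (hd0 : d ≠ 0) (hd : d < 4)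
    (hΩ : Bornology.IsBounded (Ω : Set (EuclideanSpace ℝ (Fin d))))
    {lam p : ℝ} (hlam : 0 ≤ lam) (hp : 0 < p) (f : HNeg 2 Ω) :
    ∃! u : H0 2 Ω, IsWeakSolution lam p f u := by
  have : NeZero d := ⟨hd0⟩
  obtain ⟨K, hK, hcoer⟩ := exists_norm_sq_le_norm_laplacian_sq hΩ
  obtain ⟨C, hC, hsup⟩ := exists_ae_abs_toL2_le (Ω := Ω) hd
  have h1 : ∀ u v : L2 Ω, ∫ x in Ω, u x * v x = inner ℝ u v := by
    intro u v
    rw [MeasureTheory.L2.inner_def]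
    simp [mul_comm]
  have hD : ∀ u : H0 2 Ω, ‖u‖ ^ 2 ≤ K * ‖H0.laplacianCLM u‖ ^ 2 := fun u => by
    rw [H0.laplacianCLM_apply]
    exact hcoer u.1 u.2
  have hT : ∀ u : H0 2 Ω, ∀ᵐ x ∂volume.restrict (Ω : Set (EuclideanSpace ℝ (Fin d))),
      |H0.toL2CLM u x| ≤ C * ‖u‖ := fun u => hsup u.1 u.2
  have key := existsUnique_forall_inner_add_integral_eq (V := H0 2 Ω) (F := L2 Ω)
    (D := H0.laplacianCLM) (T := H0.toL2CLM) f hK hC hlam (by positivity : 0 < 2 * p)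
  replace key := key hD hT
  have e : ∀ u : H0 2 Ω, (∀ v : H0 2 Ω, inner ℝ (H0.laplacianCLM u) (H0.laplacianCLM v) +
      lam * ∫ x in Ω, |H0.toL2CLM u x| ^ (2 * p) * H0.toL2CLM u x * H0.toL2CLM v x = f v) ↔
      IsWeakSolution lam p f u := by
    intro u
    unfold IsWeakSolution
    simp only [H0.laplacianCLM_apply, H0.toL2CLM_apply, h1]
  simp only [e] at key
  exact key

end PlateBending

end

theorem theorem2 (d : ℕ) (hd : d = 2 ∨ d = 3)
    (Ω : TopologicalSpace.Opens (EuclideanSpace ℝ (Fin d)))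
    (hΩ : Bornology.IsBounded (Ω : Set (EuclideanSpace ℝ (Fin d))))
    (lam p : ℝ) (hlam : 0 < lam) (hp : 0 < p) (f : PlateBending.HNeg 2 Ω) :
    (∀ u v : PlateBending.H0 2 Ω,
      MeasureTheory.IntegrableOn
        (fun x => |PlateBending.H.toL2 u.1 x| ^ (2 * p) * PlateBending.H.toL2 u.1 x *
          PlateBending.H.toL2 v.1 x) (Ω : Set (EuclideanSpace ℝ (Fin d)))) ∧
      ∃! u : PlateBending.H0 2 Ω, PlateBending.IsWeakSolution lam p f u := by
  refine ⟨fun u v => ?_, PlateBending.existsUnique_isWeakSolution (by lia) (by lia) hΩ hlam.le hp f⟩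
  obtain ⟨C, -, hC⟩ := PlateBending.exists_ae_abs_toL2_le (Ω := Ω) (by lia)
  exact PlateBending.integrableOn_abs_rpow_mul hΩ (by positivity) (hC u.1 u.2)
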